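/- Let $n\ge 1$, $\mu\in\mathbb R^n$, let $\Sigma\in\mathbb R^{n\times n}$ be symmetric positive definite, $D=\Sigma^{-1}$, and for $\theta>0$ let $$h_\theta(x)=\theta\sum_{i=1}^n e^{\mu_i}e^{x_i}+\tfrac12\,x^\top D x ,\qquad x\in\mathbb R^n .$$ Write $\log_1\theta=\log\theta$ and $\log_{k+1}\theta=\log\log_k\theta$; $D_{i,\cdot}$ is the $i$th row of $D$, and $D_{A,B}$ is the submatrix with rows in $A$ and columns in $B$. **Algorithm.** 1. Let $\beta_{\cdot,1}$ minimise $w^\top Dw$ over $\{w\in\mathbb R^n: w_i\le -1 \text{ for all } i\}$, and put $F_+(1)=\emptyset$, $F_*(1)=\{i: D_{i,\cdot}\beta_{\cdot,1}<0\}$, $F_0(1)=\{i:\beta_{i,1}=-1,\ D_{i,\cdot}\beta_{\cdot,1}=0\}$, $F_-(1)=\{i:\beta_{i,1}<-1\}$. 2. For $k=2,\dots,n+1$ let $\beta_{\cdot,k}$ minimise $w^\top Dw$ subject to $w_i=0$ for $i\in F_+(k-1)$, $w_i=1$ for $i\in F_*(k-1)$, $w_i\le 0$ for $i\in F_0(k-1)$,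 and $D_{i,\cdot}w=0$ for $i\in F_-(k-1)$. Put $$\begin{aligned}F_+(k)&=F_+(k-1)\cup F_*(k-1),\\ F_*(k)&=\{i\in F_0(k-1):\beta_{i,k}=0,\ D_{i,\cdot}\beta_{\cdot,k}<0\},\\ F_0(k)&=\{i\in F_0(k-1):\beta_{i,k}=0,\ D_{i,\cdot}\beta_{\cdot,k}=0\},\\ F_-(k)&=F_-(k-1)\cup\{i\in F_0(k-1):\beta_{i,k}<0\}.\end{aligned}$$ 3. Put $F_+=F_+(n+1)$, $F_-=F_-(n+1)$. For $i\in F_+$ let $\ell_i$ be the first $j\ge1$ with $D_{i,\cdot}\beta_{\cdot,j}<0$, $k_i=\ell_i+1$ and $c_i=\log(-D_{i,\cdot}\beta_{\cdot,\ell_i})$. Writing subscripts $\pm$ for restriction to $F_\pm$, put $C=-D_{--}^{-1}D_{-+}$ and $c_-=C(c_+-\mu_+)+\mu_-$. **Theorem.** For every $\theta>0$ the function $h_\theta$ has a unique minimiser $x^*=x^*(\theta)\in\mathbb R^n$. The algorithm is well defined and has the following properties. * Every minimisation in it has a unique solution, and $F_+(k),F_*(k),F_0(k),F_-(k)$ partition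 $\{1,\dots,n\}$ for every $k\ge1$. * $D_{i,\cdot}\beta_{\cdot,1}\le0$ when $\beta_{i,1}=-1$, and $D_{i,\cdot}\beta_{\cdot,1}=0$ when $\beta_{i,1}<-1$. * For $k\ge2$ and $i\in F_0(k-1)$ one has $D_{i,\cdot}\beta_{\cdot,k}\le0$, with equality when $\beta_{i,k}<0$; if $F_0(k-1)\ne\emptyset$, then $D_{i,\cdot}\beta_{\cdot,k}<0$ for at least one $i\in F_0(k-1)$. * If $F_0(k-1)=\emptyset$ for some $k\ge2$, the loop may be stopped after step $k$: for all $m>k$, $\beta_{\cdot,m}=0$, $F_\pm(m)=F_\pm(k)$ and $F_*(m)=F_0(m)=\emptyset$ (step 2 being continued to all $k\ge 2$). The sets $F_+$ and $F_-$ partition $\{1,\dots,n\}$, $F_-(1)\subseteq F_-$, $D_{--}$ is invertible, and as $\theta\to\infty$: * for $i\in F_+$, the index $\ell_i$ exists, $1<k_i\le n+1$ (and $k_i\le n$ if $n\ge2$ and $F_0(n-1)=\emptyset$), and $$x_i^*=-\log\theta+\log_{k_i}\theta-\mu_i+c_i+o(1);$$ * for all $i\in\{1,\dots,n\}$, in particular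 for $i\in F_-$, $$x_i^*=\sum_{j=1}^{n+1}\beta_{i,j}\log_j\theta-\mu_i+c_i+o(1);$$ * $\beta_{i,1}<-1$ for $i\in F_-(1)$, and for each $i\in F_-\setminus F_-(1)$ there is $1<k_i\le n$ with $\beta_{i,1}=-1$, $\beta_{i,2}=\dots=\beta_{i,k_i-1}=0$, $\beta_{i,k_i}<0$; * $x^*_-=C\,x^*_++o(1)$. -/

import Mathlib

open Filter Topology Matrix

namespace LognormalSum

noncomputable section

/-- The function `h_θ(x) = θ ∑ᵢ e^{μᵢ} e^{xᵢ} + ½ xᵀ D x`. -/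
def hTheta {n : ℕ} (μ : Fin n → ℝ) (D : Matrix (Fin n) (Fin n) ℝ) (θ : ℝ) (x : Fin n → ℝ) : ℝ :=
  θ * ∑ i, Real.exp (μ i) * Real.exp (x i) + (1 / 2) * (x ⬝ᵥ (D *ᵥ x))

/-- The iterated logarithm: `log₁ θ = log θ`, `log_{k+1} θ = log (log_k θ)`. -/
def iterLog (k : ℕ) (θ : ℝ) : ℝ := Real.log^[k] θ

/-- The quadratic form `wᵀ D w`. -/
def quad {n : ℕ} (D : Matrix (Fin n) (Fin n) ℝ) (w : Fin n → ℝ) : ℝ := w ⬝ᵥ (D *ᵥ w)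

/-- `w` is a point of `S` at which `f` attains its minimum over `S`. -/
def IsMinimiser {n : ℕ} (f : (Fin n → ℝ) → ℝ) (S : Set (Fin n → ℝ)) (w : Fin n → ℝ) : Prop :=
  w ∈ S ∧ IsMinOn f S w

open Classical in
/-- A minimiser of `f` over `S` (the zero vector if there is none). -/
def argmin {n : ℕ} (f : (Fin n → ℝ) → ℝ) (S : Set (Fin n → ℝ)) : Fin n → ℝ :=
  if h : ∃ w, IsMinimiser f S w then h.choose else 0

/-- The output of one step of the algorithm: the column `β_{·,k}` and the four index sets
`F₊(k)`, `F_*(k)`, `F₀(k)`, `F₋(k)`. -/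
structure StepData (n : ℕ) where
  beta : Fin n → ℝ
  plus : Finset (Fin n)
  star : Finset (Fin n)
  zero : Finset (Fin n)
  minus : Finset (Fin n)

/-- The search set of the first step: `wᵢ ≤ -1` for all `i`. -/
def firstSet (n : ℕ) : Set (Fin n → ℝ) := {w | ∀ i, w i ≤ -1}

/-- The first step. -/
def firstStep {n : ℕ} (D : Matrix (Fin n) (Fin n) ℝ) : StepData n :=
  let b := argmin (quad D) (firstSet n)
  { beta := b
    plus := ∅
    star := Finset.univ.filter fun i => (D *ᵥ b) i < 0
    zero := Finset.univ.filter fun i => b i = -1 ∧ (D *ᵥ b) i = 0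
    minus := Finset.univ.filter fun i => b i < -1 }

/-- The search set of a later step, given the outcome `s` of the step before it. -/
def nextSet {n : ℕ} (D : Matrix (Fin n) (Fin n) ℝ) (s : StepData n) : Set (Fin n → ℝ) :=
  {w | (∀ i ∈ s.plus, w i = 0) ∧ (∀ i ∈ s.star, w i = 1) ∧ (∀ i ∈ s.zero, w i ≤ 0) ∧
    (∀ i ∈ s.minus, (D *ᵥ w) i = 0)}

/-- A later step, given the outcome `s` of the step before it. -/
def nextStep {n : ℕ} (D : Matrix (Fin n) (Fin n) ℝ) (s : StepData n) : StepData n :=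
  let b := argmin (quad D) (nextSet D s)
  { beta := b
    plus := s.plus ∪ s.star
    star := s.zero.filter fun i => b i = 0 ∧ (D *ᵥ b) i < 0
    zero := s.zero.filter fun i => b i = 0 ∧ (D *ᵥ b) i = 0
    minus := s.minus ∪ s.zero.filter fun i => b i < 0 }

/-- The outcome of step `k = 1, 2, …` of the algorithm. (The value at `k = 0` is a placeholder.) -/
def step {n : ℕ} (D : Matrix (Fin n) (Fin n) ℝ) : ℕ → StepData n
  | 0 => ⟨0, ∅, ∅, Finset.univ, ∅⟩
  | 1 => firstStep D
  | k + 2 => nextStep D (step D (k + 1))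

/-- The coefficient `β_{i,j}`. -/
def beta {n : ℕ} (D : Matrix (Fin n) (Fin n) ℝ) (i : Fin n) (j : ℕ) : ℝ := (step D j).beta i

/-- The number `D_{i,·} β_{·,j}`. -/
def rowBeta {n : ℕ} (D : Matrix (Fin n) (Fin n) ℝ) (i : Fin n) (j : ℕ) : ℝ :=
  (D *ᵥ (step D j).beta) i

/-- The final set `F₊`; the loop of the algorithm runs over `k = 2, …, n + 1`. -/
def FPlus {n : ℕ} (D : Matrix (Fin n) (Fin n) ℝ) : Finset (Fin n) := (step D (n + 1)).plus

/-- The final set `F₋`. -/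
def FMinus {n : ℕ} (D : Matrix (Fin n) (Fin n) ℝ) : Finset (Fin n) := (step D (n + 1)).minus

/-- The submatrix of `D` with rows in `A` and columns in `B`. -/
def block {n : ℕ} (D : Matrix (Fin n) (Fin n) ℝ) (A B : Finset (Fin n)) : Matrix A B ℝ :=
  D.submatrix Subtype.val Subtype.val

/-- The matrix `C = -D₋₋⁻¹ D₋₊`. -/
def CMat {n : ℕ} (D : Matrix (Fin n) (Fin n) ℝ) : Matrix (FMinus D) (FPlus D) ℝ :=
  -((block D (FMinus D) (FMinus D))⁻¹ * block D (FMinus D) (FPlus D))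

/-- `ℓᵢ`, the first index `j ≥ 1` with `D_{i,·} β_{·,j} < 0`. -/
def ell {n : ℕ} (D : Matrix (Fin n) (Fin n) ℝ) (i : Fin n) : ℕ :=
  sInf {j : ℕ | 1 ≤ j ∧ rowBeta D i j < 0}

/-- `log (-D_{i,·} β_{·,ℓᵢ})`, the value of `cᵢ` for `i ∈ F₊`. -/
def cPlus {n : ℕ} (D : Matrix (Fin n) (Fin n) ℝ) (i : Fin n) : ℝ :=
  Real.log (-rowBeta D i (ell D i))

/-- The vector `c`, with `c₋ = -D₋₋⁻¹ D₋₊ (c₊ - μ₊) + μ₋` on `F₋`. -/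
def cVec {n : ℕ} (μ : Fin n → ℝ) (D : Matrix (Fin n) (Fin n) ℝ) (i : Fin n) : ℝ :=
  if h : i ∈ FMinus D then
    (CMat D *ᵥ fun p : FPlus D => cPlus D p.1 - μ p.1) ⟨i, h⟩ + μ i
  else cPlus D i

/-- The four sets of `s` are pairwise disjoint and cover all indices. -/
def StepData.IsPartition {n : ℕ} (s : StepData n) : Prop :=
  s.plus ∪ s.star ∪ s.zero ∪ s.minus = Finset.univ ∧
    Disjoint s.plus s.star ∧ Disjoint s.plus s.zero ∧ Disjoint s.plus s.minus ∧
    Disjoint s.star s.zero ∧ Disjoint s.star s.minus ∧ Disjoint s.zero s.minus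

/-- The algorithm is well defined and has the properties that its description refers to: every
minimisation has a unique solution, which is the vector `β_{·,k}`; the signs of `D_{i,·} β_{·,k}`
are as described; the sets of every step form a partition, and nothing changes after a step `k`
with `F₀(k-1) = ∅`, so that stopping there is harmless. -/
def AlgorithmSound {n : ℕ} (D : Matrix (Fin n) (Fin n) ℝ) : Prop :=
  (∀ w, IsMinimiser (quad D) (firstSet n) w ↔ w = (step D 1).beta) ∧
  (∀ i, beta D i 1 = -1 → rowBeta D i 1 ≤ 0) ∧
  (∀ i, beta D i 1 < -1 → rowBeta D i 1 = 0) ∧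
  (∀ k, 2 ≤ k →
    (∀ w, IsMinimiser (quad D) (nextSet D (step D (k - 1))) w ↔ w = (step D k).beta) ∧
    (∀ i ∈ (step D (k - 1)).zero, rowBeta D i k ≤ 0) ∧
    (∀ i ∈ (step D (k - 1)).zero, beta D i k < 0 → rowBeta D i k = 0) ∧
    ((step D (k - 1)).zero.Nonempty → ∃ i ∈ (step D (k - 1)).zero, rowBeta D i k < 0)) ∧
  (∀ k, 1 ≤ k → (step D k).IsPartition) ∧
  (∀ k, 2 ≤ k → (step D (k - 1)).zero = ∅ →
    ∀ m, k < m → step D m = ⟨0, (step D k).plus, ∅, ∅, (step D k).minus⟩)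

end

end LognormalSum

namespace LognormalSum

variable {n : ℕ} {D : Matrix (Fin n) (Fin n) ℝ}

/-! ### The quadratic form of a positive definite matrix -/

/-! Put y(θ) = ∑ⱼ β_{·,j} log_j θ − μ + c. The gradient of h_θ at y has entries θ e^{μᵢ + yᵢ} + (D
y)ᵢ. On F₋ the linear part vanishes exactly (`mulVec_approxMin_FMinus`), and the exponential part
tends to 0 because the leading coefficient of log θ + yᵢ is negative. On F₊ one has yᵢ = −log θ +
log_{ℓᵢ+1} θ − μᵢ + cᵢ, so the exponential part is e^{cᵢ} log_{ℓᵢ} θ; the choice of cᵢ makes it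
cancel the leading term of (D y)ᵢ and leaves O(log_{ℓᵢ+1} θ). This residue may diverge, but its
square is negligible against log_{ℓᵢ} θ, the order of the curvature of the exponential term
(`tendsto_sq_gradTheta_div_FPlus`). Monotonicity of the gradient (`quad_sub_eq`) and the scalar
inequality `mul_sub_one_sub_exp_neg_mul_le` then bound the distance from y to the minimiser
(`sq_norm_sub_le`), and it tends to 0.

Each step of the algorithm minimises a positive definite form over one type of polyhedron, so
existence, uniqueness and the signs of D β follow from `existsUnique_minimiser` and
`IsMinimiser.kkt`. Termination rests on `exists_rowBeta_neg`: without a strict inequality on a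
non-empty F₀, the sum of all columns so far would vanish, since on F₊ the coefficients add up to −1
+ 1 and elsewhere D annihilates the sum; but on F₀ the sum is at most −1. Hence F₀ shrinks strictly
until it is empty. -/

theorem dotProduct_mulVec_symm (hD : D.PosDef) (v w : Fin n → ℝ) :
    v ⬝ᵥ (D *ᵥ w) = w ⬝ᵥ (D *ᵥ v) := by
  have hT : Dᵀ = D := by simpa using hD.isHermitian.eq
  rw [dotProduct_mulVec, ← mulVec_transpose, hT, dotProduct_comm]

theorem quad_pos (hD : D.PosDef) {w : Fin n → ℝ} (hw : w ≠ 0) : 0 < quad D w := by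
  simpa [quad] using hD.dotProduct_mulVec_pos hw

theorem eq_zero_of_quad_nonpos (hD : D.PosDef) {w : Fin n → ℝ} (h : quad D w ≤ 0) : w = 0 := by
  by_contra hw
  exact absurd (quad_pos hD hw) (not_lt.2 h)

theorem quad_nonneg (hD : D.PosDef) (w : Fin n → ℝ) : 0 ≤ quad D w := by
  by_contra! h
  obtain rfl := eq_zero_of_quad_nonpos hD h.le
  simp [quad] at h

theorem quad_add_smul (hD : D.PosDef) (w v : Fin n → ℝ) (t : ℝ) :
    quad D (w + t • v) = quad D w + 2 * t * (v ⬝ᵥ (D *ᵥ w)) + t ^ 2 * quad D v := by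
  simp only [quad, mulVec_add, mulVec_smul, dotProduct_add, add_dotProduct, smul_dotProduct,
    dotProduct_smul, smul_eq_mul, dotProduct_mulVec_symm hD w v]
  ring

theorem continuous_quad (D : Matrix (Fin n) (Fin n) ℝ) : Continuous (quad D) := by
  unfold quad
  fun_prop

/-- A vector each of whose coordinates vanishes in `v` or in `D v` is zero. -/
theorem eq_zero_of_complementary (hD : D.PosDef) {v : Fin n → ℝ}
    (h : ∀ i, v i = 0 ∨ (D *ᵥ v) i = 0) : v = 0 := by
  refine eq_zero_of_quad_nonpos hD (le_of_eq ?_)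
  unfold quad dotProduct
  refine Finset.sum_eq_zero fun i _ => ?_
  rcases h i with h | h <;> simp [h]

/-- One may prescribe `v` off `M` and `D v` on `M`. -/
theorem exists_mixed_solution (hD : D.PosDef) (M : Finset (Fin n)) (w : Fin n → ℝ) :
    ∃ v : Fin n → ℝ, (∀ i ∉ M, v i = w i) ∧ ∀ i ∈ M, (D *ᵥ v) i = 0 := by
  -- Complementarity makes this endomorphism injective, hence surjective by finite dimension.
  let T : (Fin n → ℝ) →ₗ[ℝ] (Fin n → ℝ) :=
    { toFun := fun v i => if i ∈ M then (D *ᵥ v) i else v i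
      map_add' := fun u v => by
        ext i; by_cases hi : i ∈ M <;> simp [hi, mulVec_add]
      map_smul' := fun c v => by
        ext i; by_cases hi : i ∈ M <;> simp [hi, mulVec_smul] }
  have hT : ∀ v i, T v i = if i ∈ M then (D *ᵥ v) i else v i := fun _ _ => rfl
  have hinj : Function.Injective T := by
    rw [injective_iff_map_eq_zero]
    intro v hv
    refine eq_zero_of_complementary hD fun i => ?_
    have h := congrFun hv i
    rw [hT] at h
    by_cases hi : i ∈ M
    · exact Or.inr (by simpa [hi] using h)
    · exact Or.inl (by simpa [hi] using h)
  obtain ⟨v, hv⟩ := LinearMap.injective_iff_surjective.1 hinj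
    (fun i => if i ∈ M then 0 else w i)
  refine ⟨v, fun i hi => ?_, fun i hi => ?_⟩
  · simpa [hT, hi] using congrFun hv i
  · simpa [hT, hi] using congrFun hv i

/-- Homogeneity reduces the bound to the compact unit sphere, where the form attains a positive
minimum. The sphere is empty only when n = 0. -/
theorem exists_coercivity_constant (hD : D.PosDef) :
    ∃ l : ℝ, 0 < l ∧ ∀ w : Fin n → ℝ, l * ‖w‖ ^ 2 ≤ quad D w := by
  rcases (Metric.sphere (0 : Fin n → ℝ) 1).eq_empty_or_nonempty with he | hne
  · refine ⟨1, one_pos, fun w => ?_⟩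
    have hw : w = 0 := by
      by_contra hw
      have : ‖w‖⁻¹ • w ∈ Metric.sphere (0 : Fin n → ℝ) 1 := by
        simp [norm_smul, inv_mul_cancel₀ (norm_ne_zero_iff.2 hw)]
      simp [he] at this
    simp [hw, quad]
  · obtain ⟨u, hu, hmin⟩ := (isCompact_sphere (0 : Fin n → ℝ) 1).exists_isMinOn hne
      (continuous_quad D).continuousOn
    have hu0 : u ≠ 0 := by
      rintro rfl
      simp at hu
    refine ⟨quad D u, quad_pos hD hu0, fun w => ?_⟩
    by_cases hw : w = 0
    · simp [hw, quad]
    have hw' := norm_ne_zero_iff.2 hw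
    have hmem : ‖w‖⁻¹ • w ∈ Metric.sphere (0 : Fin n → ℝ) 1 := by
      simp [norm_smul, inv_mul_cancel₀ hw']
    have h : quad D u ≤ quad D (‖w‖⁻¹ • w) := hmin hmem
    have h2 : quad D (‖w‖⁻¹ • w) = (‖w‖ ^ 2)⁻¹ * quad D w := by
      simp only [quad, mulVec_smul, smul_dotProduct, dotProduct_smul, smul_eq_mul]
      field_simp
    rw [h2, ← div_eq_inv_mul, le_div_iff₀ (by positivity)] at h
    exact h

theorem tendsto_quad_cocompact (hD : D.PosDef) :
    Tendsto (quad D) (cocompact (Fin n → ℝ)) atTop := by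
  obtain ⟨l, hl, h⟩ := exists_coercivity_constant hD
  refine tendsto_atTop_mono h (Tendsto.const_mul_atTop hl ?_)
  exact (tendsto_pow_atTop two_ne_zero).comp (tendsto_norm_cocompact_atTop)

/-! ### Minimisation under sign constraints -/

theorem dotProduct_nonneg_of_minimal (hD : D.PosDef) {w v : Fin n → ℝ} {ε : ℝ} (hε : 0 < ε)
    (h : ∀ t, 0 < t → t ≤ ε → quad D w ≤ quad D (w + t • v)) : 0 ≤ v ⬝ᵥ (D *ᵥ w) := by
  by_contra! hneg
  have hq := quad_nonneg hD v
  set a := v ⬝ᵥ (D *ᵥ w)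
  -- Then t (q + 1) ≤ −a with q the value of the form at v, so 2ta + t²q ≤ ta − t² < 0.
  set t := min ε (-a / (quad D v + 1)) with ht
  have htpos : 0 < t := lt_min hε (div_pos (by linarith) (by linarith))
  have h1 := h t htpos (min_le_left _ _)
  rw [quad_add_smul hD] at h1
  have h2 : t * (quad D v + 1) ≤ -a := by
    rw [← le_div_iff₀ (by linarith)]
    exact min_le_right _ _
  nlinarith

/-- The set of all `w` with `wᵢ = aᵢ` on `P`, `wᵢ ≤ aᵢ` on `Z` and `(D w)ᵢ = 0` on `M`. -/
def constraintSet (D : Matrix (Fin n) (Fin n) ℝ) (P Z M : Finset (Fin n)) (a : Fin n → ℝ) :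
    Set (Fin n → ℝ) :=
  {w | (∀ i ∈ P, w i = a i) ∧ (∀ i ∈ Z, w i ≤ a i) ∧ ∀ i ∈ M, (D *ᵥ w) i = 0}

variable {P Z M : Finset (Fin n)} {a : Fin n → ℝ}

theorem isClosed_constraintSet (D : Matrix (Fin n) (Fin n) ℝ) (P Z M : Finset (Fin n))
    (a : Fin n → ℝ) : IsClosed (constraintSet D P Z M a) := by
  simp only [constraintSet, Set.ofPred_and, Set.ofPred_forall]
  refine (isClosed_biInter fun i _ => ?_).inter
    ((isClosed_biInter fun i _ => ?_).inter (isClosed_biInter fun i _ => ?_))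
  · exact isClosed_eq (continuous_apply i) continuous_const
  · exact isClosed_le (continuous_apply i) continuous_const
  · exact isClosed_eq (by fun_prop) continuous_const

/-- The feasible set is closed and, by `exists_mixed_solution`, non-empty, and the form is coercive.
For uniqueness, two minimisers are compared with their midpoint, which is again feasible. -/
theorem existsUnique_minimiser (hD : D.PosDef) (hPM : Disjoint P M) (hZM : Disjoint Z M) :
    ∃! w, IsMinimiser (quad D) (constraintSet D P Z M a) w := by
  obtain ⟨v, hv, hvM⟩ := exists_mixed_solution hD M a
  have hvS : v ∈ constraintSet D P Z M a :=
    ⟨fun i hi => hv i (Finset.disjoint_left.1 hPM hi),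
      fun i hi => (hv i (Finset.disjoint_left.1 hZM hi)).le, hvM⟩
  obtain ⟨w, hwS, hw⟩ := (continuous_quad D).continuousOn.exists_isMinOn'
    (isClosed_constraintSet D P Z M a) hvS
    (((tendsto_quad_cocompact hD).mono_left inf_le_left).eventually_ge_atTop _)
  refine ⟨w, ⟨hwS, hw⟩, fun u ⟨huS, hu⟩ => ?_⟩
  have hmS : w + (1 / 2 : ℝ) • (u - w) ∈ constraintSet D P Z M a := by
    refine ⟨fun i hi => ?_, fun i hi => ?_, fun i hi => ?_⟩
    · simp [hwS.1 i hi, huS.1 i hi]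
    · have h1 := hwS.2.1 i hi
      have h2 := huS.2.1 i hi
      simp only [Pi.add_apply, Pi.smul_apply, Pi.sub_apply, smul_eq_mul]
      linarith
    · simp [mulVec_add, mulVec_smul, mulVec_sub, hwS.2.2 i hi, huS.2.2 i hi]
  have h1 : quad D w ≤ quad D (w + (1 / 2 : ℝ) • (u - w)) := hw hmS
  have h2 : quad D u ≤ quad D w := hu hwS
  have h3 : quad D u = quad D (w + (1 : ℝ) • (u - w)) := by simp
  rw [quad_add_smul hD] at h1 h3
  have h4 := eq_zero_of_quad_nonpos hD (w := u - w) (by linarith)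
  exact sub_eq_zero.1 h4

/-- The Karush–Kuhn–Tucker conditions at the inequality constraints. -/
theorem IsMinimiser.kkt (hD : D.PosDef) {w : Fin n → ℝ}
    (hw : IsMinimiser (quad D) (constraintSet D P Z M a) w)
    (hPZ : Disjoint P Z) (hPM : Disjoint P M) (hZM : Disjoint Z M) {i : Fin n} (hi : i ∈ Z) :
    (D *ᵥ w) i ≤ 0 ∧ (w i < a i → (D *ᵥ w) i = 0) := by
  obtain ⟨⟨hP, hZ, hM⟩, hmin⟩ := hw
  have hiM := Finset.disjoint_left.1 hZM hi
  -- The direction v is the unit vector eᵢ corrected on M so that D v = 0 there. Moving along v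
  -- respects every constraint except possibly the one at i, and v pairs with D w to give exactly (D
  -- w)ᵢ.
  obtain ⟨v, hv, hvM⟩ := exists_mixed_solution hD M (Pi.single i (1 : ℝ))
  have hvi : v i = 1 := by simp [hv i hiM]
  have hv0 : ∀ j ∉ M, j ≠ i → v j = 0 := fun j hj hji => by simp [hv j hj, hji]
  have hdot : v ⬝ᵥ (D *ᵥ w) = (D *ᵥ w) i := by
    unfold dotProduct
    rw [Finset.sum_eq_single i]
    · simp [hvi]
    · intro j _ hji
      by_cases hj : j ∈ M
      · simp [hM j hj]
      · simp [hv0 j hj hji]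
    · simp
  have hmem : ∀ t : ℝ, w i + t ≤ a i → quad D w ≤ quad D (w + t • v) := by
    intro t ht
    refine hmin ⟨fun j hj => ?_, fun j hj => ?_, fun j hj => ?_⟩
    · have hji : j ≠ i := fun h => Finset.disjoint_left.1 hPZ hj (h ▸ hi)
      simp [hP j hj, hv0 j (Finset.disjoint_left.1 hPM hj) hji]
    · by_cases hji : j = i
      · subst hji
        simpa [hvi] using ht
      · simpa [hv0 j (Finset.disjoint_left.1 hZM hj) hji] using hZ j hj
    · simp [mulVec_add, mulVec_smul, hM j hj, hvM j hj]
  -- The direction −v is always feasible; v itself is feasible for a short time when the constraint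
  -- at i is slack.
  have hle : (D *ᵥ w) i ≤ 0 := by
    have h := dotProduct_nonneg_of_minimal hD (w := w) (v := -v) one_pos fun t ht _ => by
      have := hmem (-t) (by linarith [hZ i hi])
      simpa using this
    rw [neg_dotProduct, hdot] at h
    linarith
  refine ⟨hle, fun hlt => le_antisymm hle ?_⟩
  have h := dotProduct_nonneg_of_minimal hD (w := w) (v := v) (sub_pos.2 hlt) fun t _ ht =>
    hmem t (by linarith)
  rwa [hdot] at h

theorem argmin_iff {f : (Fin n → ℝ) → ℝ} {S : Set (Fin n → ℝ)} (h : ∃! w, IsMinimiser f S w)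
    (w : Fin n → ℝ) : IsMinimiser f S w ↔ w = argmin f S := by
  have hs : IsMinimiser f S (argmin f S) := by
    rw [argmin, dif_pos h.exists]
    exact h.exists.choose_spec
  exact ⟨fun hw => h.unique hw hs, fun hw => hw ▸ hs⟩

/-! ### The first step -/

theorem firstSet_eq (D : Matrix (Fin n) (Fin n) ℝ) :
    firstSet n = constraintSet D ∅ Finset.univ ∅ fun _ => -1 := by
  simp [firstSet, constraintSet]

theorem isMinimiser_firstSet_iff (hD : D.PosDef) (w : Fin n → ℝ) :
    IsMinimiser (quad D) (firstSet n) w ↔ w = (step D 1).beta := by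
  refine argmin_iff ?_ w
  rw [firstSet_eq D]
  exact existsUnique_minimiser hD (by simp) (by simp)

theorem isMinimiser_beta_one (hD : D.PosDef) :
    IsMinimiser (quad D) (firstSet n) (step D 1).beta :=
  (isMinimiser_firstSet_iff hD _).2 rfl

theorem beta_one_le (hD : D.PosDef) (i : Fin n) : beta D i 1 ≤ -1 :=
  (isMinimiser_beta_one hD).1 i

theorem rowBeta_one (hD : D.PosDef) (i : Fin n) :
    rowBeta D i 1 ≤ 0 ∧ (beta D i 1 < -1 → rowBeta D i 1 = 0) := by
  have h := isMinimiser_beta_one hD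
  rw [firstSet_eq D] at h
  exact h.kkt hD (by simp) (by simp) (by simp) (Finset.mem_univ i)

theorem mem_star_one {i : Fin n} : i ∈ (step D 1).star ↔ rowBeta D i 1 < 0 := by
  simp [step, firstStep, rowBeta]

theorem mem_zero_one {i : Fin n} :
    i ∈ (step D 1).zero ↔ beta D i 1 = -1 ∧ rowBeta D i 1 = 0 := by
  simp [step, firstStep, rowBeta, beta]

theorem mem_minus_one {i : Fin n} : i ∈ (step D 1).minus ↔ beta D i 1 < -1 := by
  simp [step, firstStep, beta]

theorem plus_one : (step D 1).plus = ∅ := rfl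

theorem isPartition_step_one (hD : D.PosDef) : (step D 1).IsPartition := by
  refine ⟨?_, by simp [plus_one], by simp [plus_one], by simp [plus_one], ?_, ?_, ?_⟩
  · ext i
    simp only [plus_one, Finset.mem_union, mem_star_one, mem_zero_one, mem_minus_one,
      Finset.mem_univ, iff_true]
    rcases (beta_one_le hD i).lt_or_eq with h | h
    · exact Or.inr h
    · rcases (rowBeta_one hD i).1.lt_or_eq with h' | h'
      · exact Or.inl (Or.inl (Or.inr h'))
      · exact Or.inl (Or.inr ⟨h, h'⟩)
  · rw [Finset.disjoint_left]
    intro i h1 h2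
    exact (mem_star_one.1 h1).ne (mem_zero_one.1 h2).2
  · rw [Finset.disjoint_left]
    intro i h1 h2
    exact (mem_star_one.1 h1).ne ((rowBeta_one hD i).2 (mem_minus_one.1 h2))
  · rw [Finset.disjoint_left]
    intro i h1 h2
    exact (mem_minus_one.1 h2).ne (mem_zero_one.1 h1).1

/-! ### The later steps -/

/-- Since F_* is disjoint from F₊ and F₀, one bound vector, 1 on F_* and 0 elsewhere, encodes all
constraints off F₋. -/
theorem nextSet_eq (D : Matrix (Fin n) (Fin n) ℝ) {s : StepData n} (hs : s.IsPartition) :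
    nextSet D s = constraintSet D (s.plus ∪ s.star) s.zero s.minus
      fun i => if i ∈ s.star then 1 else 0 := by
  obtain ⟨-, hps, -, -, hsz, -, -⟩ := hs
  ext w
  simp only [nextSet, constraintSet, Set.mem_ofPred_eq, Finset.mem_union]
  constructor
  · rintro ⟨h1, h2, h3, h4⟩
    refine ⟨fun i hi => ?_, fun i hi => ?_, h4⟩
    · by_cases his : i ∈ s.star
      · simp [his, h2 i his]
      · simp [his, h1 i (hi.resolve_right his)]
    · simp [Finset.disjoint_right.1 hsz hi, h3 i hi]
  · rintro ⟨h1, h2, h3⟩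
    refine ⟨fun i hi => ?_, fun i hi => ?_, fun i hi => ?_, h3⟩
    · simpa [Finset.disjoint_left.1 hps hi] using h1 i (Or.inl hi)
    · simpa [hi] using h1 i (Or.inr hi)
    · simpa [Finset.disjoint_right.1 hsz hi] using h2 i hi

theorem isMinimiser_nextSet_iff (hD : D.PosDef) {s : StepData n} (hs : s.IsPartition)
    (w : Fin n → ℝ) : IsMinimiser (quad D) (nextSet D s) w ↔ w = (nextStep D s).beta := by
  refine argmin_iff ?_ w
  rw [nextSet_eq D hs]
  obtain ⟨-, -, -, hpm, -, hsm, hzm⟩ := hs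
  exact existsUnique_minimiser hD (Finset.disjoint_union_left.2 ⟨hpm, hsm⟩) hzm

theorem isMinimiser_nextStep (hD : D.PosDef) {s : StepData n} (hs : s.IsPartition) :
    IsMinimiser (quad D) (nextSet D s) (nextStep D s).beta :=
  (isMinimiser_nextSet_iff hD hs _).2 rfl

theorem nextStep_kkt (hD : D.PosDef) {s : StepData n} (hs : s.IsPartition) {i : Fin n}
    (hi : i ∈ s.zero) : (D *ᵥ (nextStep D s).beta) i ≤ 0 ∧
      ((nextStep D s).beta i < 0 → (D *ᵥ (nextStep D s).beta) i = 0) := by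
  have h := isMinimiser_nextStep hD hs
  rw [nextSet_eq D hs] at h
  obtain ⟨-, -, hpz, hpm, hsz, hsm, hzm⟩ := hs
  have := h.kkt hD (Finset.disjoint_union_left.2 ⟨hpz, hsz⟩)
    (Finset.disjoint_union_left.2 ⟨hpm, hsm⟩) hzm hi
  simpa [Finset.disjoint_right.1 hsz hi] using this

theorem isPartition_nextStep (hD : D.PosDef) {s : StepData n} (hs : s.IsPartition) :
    (nextStep D s).IsPartition := by
  have hkkt := fun i => @nextStep_kkt n D hD s hs i
  have hle := (isMinimiser_nextStep hD hs).1.2.2.1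
  obtain ⟨hU, hps, hpz, hpm, hsz, hsm, hzm⟩ := hs
  have hU' : ∀ i, ((i ∈ s.plus ∨ i ∈ s.star) ∨ i ∈ s.zero) ∨ i ∈ s.minus := fun i => by
    have : i ∈ s.plus ∪ s.star ∪ s.zero ∪ s.minus := hU ▸ Finset.mem_univ i
    simpa only [Finset.mem_union] using this
  rw [Finset.disjoint_left] at hps hpz hpm hsz hsm hzm
  set b := (nextStep D s).beta with hb
  have hp : (nextStep D s).plus = s.plus ∪ s.star := rfl
  have hst : (nextStep D s).star = s.zero.filter fun i => b i = 0 ∧ (D *ᵥ b) i < 0 := rfl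
  have hz : (nextStep D s).zero = s.zero.filter fun i => b i = 0 ∧ (D *ᵥ b) i = 0 := rfl
  have hm : (nextStep D s).minus = s.minus ∪ s.zero.filter fun i => b i < 0 := rfl
  refine ⟨?_, ?_, ?_, ?_, ?_, ?_, ?_⟩
  · ext i
    simp only [hp, hst, hz, hm, Finset.mem_union, Finset.mem_filter, Finset.mem_univ, iff_true]
    have h1 := hU' i
    by_cases hi : i ∈ s.zero
    · rcases (hle i hi).lt_or_eq with h | h
      · tauto
      · rcases (hkkt i hi).1.lt_or_eq with h' | h' <;> tauto
    · tauto
  all_goals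
    rw [Finset.disjoint_left]
    intro i
    simp only [hp, hst, hz, hm, Finset.mem_union, Finset.mem_filter]
    have h1 := @hps i
    have h2 := @hpz i
    have h3 := @hpm i
    have h4 := @hsz i
    have h5 := @hsm i
    have h6 := @hzm i
    clear hps hpz hpm hsz hsm hzm hU hU' hkkt hle hp hst hz hm
    grind

theorem isPartition_step (hD : D.PosDef) (k : ℕ) : (step D (k + 1)).IsPartition := by
  induction k with
  | zero => exact isPartition_step_one hD
  | succ k ih => exact isPartition_nextStep hD ih

theorem beta_mem_nextSet (hD : D.PosDef) (k : ℕ) :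
    (step D (k + 2)).beta ∈ nextSet D (step D (k + 1)) :=
  (isMinimiser_nextStep hD (isPartition_step hD k)).1

theorem rowBeta_add_two (hD : D.PosDef) {k : ℕ} {i : Fin n} (hi : i ∈ (step D (k + 1)).zero) :
    rowBeta D i (k + 2) ≤ 0 ∧ (beta D i (k + 2) < 0 → rowBeta D i (k + 2) = 0) :=
  nextStep_kkt hD (isPartition_step hD k) hi

theorem mem_plus_add_two {k : ℕ} {i : Fin n} :
    i ∈ (step D (k + 2)).plus ↔ i ∈ (step D (k + 1)).plus ∨ i ∈ (step D (k + 1)).star := by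
  simp [step, nextStep]

theorem mem_star_add_two {k : ℕ} {i : Fin n} : i ∈ (step D (k + 2)).star ↔
    i ∈ (step D (k + 1)).zero ∧ beta D i (k + 2) = 0 ∧ rowBeta D i (k + 2) < 0 := by
  simp [step, nextStep, beta, rowBeta]

theorem mem_zero_add_two {k : ℕ} {i : Fin n} : i ∈ (step D (k + 2)).zero ↔
    i ∈ (step D (k + 1)).zero ∧ beta D i (k + 2) = 0 ∧ rowBeta D i (k + 2) = 0 := by
  simp [step, nextStep, beta, rowBeta]

theorem mem_minus_add_two {k : ℕ} {i : Fin n} : i ∈ (step D (k + 2)).minus ↔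
    i ∈ (step D (k + 1)).minus ∨ i ∈ (step D (k + 1)).zero ∧ beta D i (k + 2) < 0 := by
  simp [step, nextStep, beta]

/-! ### History of an index through the steps -/

theorem forall_le_succ {p : ℕ → Prop} {a k : ℕ} (h : ∀ j, a ≤ j → j ≤ k → p j)
    (hk : p (k + 1)) : ∀ j, a ≤ j → j ≤ k + 1 → p j := fun j h1 h2 => by
  rcases h2.lt_or_eq with h3 | rfl
  · exact h j h1 (Nat.lt_succ_iff.1 h3)
  · exact hk

theorem zero_history {k : ℕ} {i : Fin n} (hi : i ∈ (step D (k + 1)).zero) :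
    beta D i 1 = -1 ∧ (∀ j, 2 ≤ j → j ≤ k + 1 → beta D i j = 0) ∧
      ∀ j, 1 ≤ j → j ≤ k + 1 → rowBeta D i j = 0 := by
  induction k with
  | zero =>
    obtain ⟨h1, h2⟩ := mem_zero_one.1 hi
    refine ⟨h1, fun j _ _ => by omega, fun j _ _ => ?_⟩
    obtain rfl : j = 1 := by omega
    exact h2
  | succ k ih =>
    obtain ⟨h0, h1, h2⟩ := mem_zero_add_two.1 hi
    obtain ⟨a1, a2, a3⟩ := ih h0
    exact ⟨a1, forall_le_succ a2 h1, forall_le_succ a3 h2⟩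

theorem star_history (hD : D.PosDef) {k : ℕ} {i : Fin n} (hi : i ∈ (step D (k + 1)).star) :
    beta D i 1 = -1 ∧ (∀ j, 2 ≤ j → j ≤ k + 1 → beta D i j = 0) ∧
      (∀ j, 1 ≤ j → j ≤ k → rowBeta D i j = 0) ∧ rowBeta D i (k + 1) < 0 := by
  cases k with
  | zero =>
    have h := mem_star_one.1 hi
    refine ⟨?_, fun j _ _ => by omega, fun j _ _ => by omega, h⟩
    refine (beta_one_le hD i).lt_or_eq.resolve_left fun h' => h.ne ((rowBeta_one hD i).2 h')
  | succ k =>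
    obtain ⟨h0, h1, h2⟩ := mem_star_add_two.1 hi
    obtain ⟨a1, a2, a3⟩ := zero_history h0
    exact ⟨a1, forall_le_succ a2 h1, a3, h2⟩

/-- The constraints force a single 1 in the step after the index was in F_*, and zeros from then on.
As l ≥ 1, the two indicators never coincide. This pattern yields −log θ + log_{l+1} θ in the
expansion. -/
theorem plus_history (hD : D.PosDef) {k : ℕ} {i : Fin n} (hi : i ∈ (step D (k + 1)).plus) :
    ∃ l, 1 ≤ l ∧ l ≤ k ∧ i ∈ (step D l).star ∧ ∀ j, 1 ≤ j → j ≤ k + 1 →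
      beta D i j = (if j = 1 then -1 else 0) + (if j = l + 1 then 1 else 0) := by
  induction k with
  | zero => simp [plus_one] at hi
  | succ k ih =>
    rcases mem_plus_add_two.1 hi with h | h
    · obtain ⟨l, h1, h2, h3, h4⟩ := ih h
      refine ⟨l, h1, by omega, h3, forall_le_succ h4 ?_⟩
      have : beta D i (k + 2) = 0 := (beta_mem_nextSet hD k).1 i h
      rw [this, if_neg (by omega), if_neg (by omega), add_zero]
    · obtain ⟨h1, h2, -, -⟩ := star_history hD h
      refine ⟨k + 1, by omega, le_rfl, h, forall_le_succ (fun j hj1 hj2 => ?_) ?_⟩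
      · by_cases hj : j = 1
        · subst hj
          simp [h1]
        · rw [h2 j (by omega) hj2, if_neg hj, if_neg (by omega), add_zero]
      · have : beta D i (k + 2) = 1 := (beta_mem_nextSet hD k).2.1 i h
        simp [this]

/-- The rows vanish before entry by membership in F₀, at entry by complementary slackness, and
afterwards by the constraint on F₋. The entry step is m + 2, unless it is the first. -/
theorem minus_history (hD : D.PosDef) {k : ℕ} {i : Fin n} (hi : i ∈ (step D (k + 1)).minus) :
    (∀ j, 1 ≤ j → j ≤ k + 1 → rowBeta D i j = 0) ∧ (i ∈ (step D 1).minus ∨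
      beta D i 1 = -1 ∧ ∃ m, m + 2 ≤ k + 1 ∧ i ∈ (step D (m + 1)).zero ∧
        (∀ j, 2 ≤ j → j < m + 2 → beta D i j = 0) ∧ beta D i (m + 2) < 0) := by
  induction k with
  | zero =>
    refine ⟨fun j _ _ => ?_, Or.inl hi⟩
    obtain rfl : j = 1 := by omega
    exact (rowBeta_one hD i).2 (mem_minus_one.1 hi)
  | succ k ih =>
    rcases mem_minus_add_two.1 hi with h | ⟨h, h'⟩
    · obtain ⟨h1, h2⟩ := ih h
      refine ⟨forall_le_succ h1 ((beta_mem_nextSet hD k).2.2.2 i h), h2.imp_right ?_⟩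
      rintro ⟨h3, m, h4, h5⟩
      exact ⟨h3, m, by omega, h5⟩
    · obtain ⟨h1, h2, h3⟩ := zero_history h
      refine ⟨forall_le_succ h3 ((rowBeta_add_two hD h).2 h'), Or.inr ⟨h1, k, le_rfl, h, ?_, h'⟩⟩
      exact fun j hj1 hj2 => h2 j hj1 (by omega)

/-- As long as `F₀` is non-empty, the next step leaves a strict inequality at one of its indices. -/
theorem exists_rowBeta_neg (hD : D.PosDef) {k : ℕ} (hne : (step D (k + 1)).zero.Nonempty) :
    ∃ i ∈ (step D (k + 1)).zero, rowBeta D i (k + 2) < 0 := by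
  by_contra! hcon
  -- Under the contrary assumption this sum vanishes on F₊(k+2), and D times it vanishes at all
  -- other indices, so it is zero.
  set S : Fin n → ℝ := ∑ j ∈ Finset.Icc 1 (k + 2), (step D j).beta with hS
  have hSi : ∀ i, S i = ∑ j ∈ Finset.Icc 1 (k + 2), beta D i j := fun i => by
    simp [hS, beta]
  have hDS : ∀ i, (D *ᵥ S) i = ∑ j ∈ Finset.Icc 1 (k + 2), rowBeta D i j := fun i => by
    simp [hS, rowBeta, Matrix.mulVec_sum]
  have hS0 : S = 0 := by
    refine eq_zero_of_complementary hD fun i => ?_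
    have hi : i ∈ (step D (k + 1)).plus ∪ (step D (k + 1)).star ∪ (step D (k + 1)).zero ∪
        (step D (k + 1)).minus := (isPartition_step hD k).1 ▸ Finset.mem_univ i
    simp only [Finset.mem_union, ← mem_plus_add_two] at hi
    rcases hi with (hi | hi) | hi
    · left
      obtain ⟨l, hl1, hl2, -, hl⟩ := plus_history hD hi
      rw [hSi, Finset.sum_congr rfl fun j hj =>
        hl j (Finset.mem_Icc.1 hj).1 (Finset.mem_Icc.1 hj).2]
      rw [Finset.sum_add_distrib, Finset.sum_ite_eq', Finset.sum_ite_eq',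
        if_pos (by simp), if_pos (Finset.mem_Icc.2 (by omega))]
      norm_num
    · right
      rw [hDS]
      refine Finset.sum_eq_zero fun j hj => ?_
      rw [Finset.mem_Icc] at hj
      exact forall_le_succ (zero_history hi).2.2
        (le_antisymm (rowBeta_add_two hD hi).1 (hcon i hi)) j hj.1 hj.2
    · right
      rw [hDS]
      refine Finset.sum_eq_zero fun j hj => ?_
      rw [Finset.mem_Icc] at hj
      exact forall_le_succ (minus_history hD hi).1 ((beta_mem_nextSet hD k).2.2.2 i hi)
        j hj.1 hj.2
  obtain ⟨i, hi⟩ := hne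
  obtain ⟨h1, h2, -⟩ := zero_history hi
  have h3 : beta D i (k + 2) ≤ 0 := (beta_mem_nextSet hD k).2.2.1 i hi
  -- On F₀(k+1) only the first and the last column can contribute, which contradicts S = 0.
  have h4 : S i = -1 + beta D i (k + 2) := by
    rw [hSi, Finset.sum_Icc_succ_top (by omega), Finset.sum_eq_single_of_mem 1 (by simp), h1]
    intro j hj hj1
    rw [Finset.mem_Icc] at hj
    exact h2 j (by omega) hj.2
  rw [hS0] at h4
  simp only [Pi.zero_apply] at h4
  linarith

/-- The index with a strict inequality leaves F₀, so each step costs at least one element. The first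
step already misses one: otherwise D β = 0, hence β = 0, against β = −1 on F₀. -/
theorem card_zero_lt (hD : D.PosDef) {k : ℕ} (hne : (step D (k + 1)).zero.Nonempty) :
    (step D (k + 1)).zero.card + (k + 1) ≤ n := by
  induction k with
  | zero =>
    obtain ⟨i, hi⟩ := hne
    suffices h : ∃ j, j ∉ (step D 1).zero by
      obtain ⟨j, hj⟩ := h
      have := Finset.card_lt_univ_of_notMem hj
      simpa using this
    by_contra! hall
    have h0 : (step D 1).beta = 0 :=
      eq_zero_of_complementary hD fun j => Or.inr (mem_zero_one.1 (hall j)).2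
    have h1 := (mem_zero_one.1 hi).1
    simp [beta, h0] at h1
  | succ k ih =>
    have hsub : (step D (k + 2)).zero ⊆ (step D (k + 1)).zero :=
      fun i hi => (mem_zero_add_two.1 hi).1
    have hne' := hne.mono hsub
    obtain ⟨i, hi, hneg⟩ := exists_rowBeta_neg hD hne'
    have hlt : (step D (k + 2)).zero.card < (step D (k + 1)).zero.card :=
      Finset.card_lt_card ⟨hsub, fun h => hneg.ne (mem_zero_add_two.1 (h hi)).2.2⟩
    have := ih hne'
    change (step D (k + 2)).zero.card + _ ≤ n
    omega

theorem lt_of_zero_nonempty (hD : D.PosDef) {k : ℕ} (hne : (step D (k + 1)).zero.Nonempty) :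
    k + 2 ≤ n := by
  have := card_zero_lt hD hne
  have := hne.card_pos
  omega

/-! ### Behaviour once F₀ is empty -/

theorem star_add_two_eq_empty {k : ℕ} (h : (step D (k + 1)).zero = ∅) :
    (step D (k + 2)).star = ∅ :=
  Finset.eq_empty_of_forall_notMem fun i hi => by simpa [h] using (mem_star_add_two.1 hi).1

theorem zero_add_two_eq_empty {k : ℕ} (h : (step D (k + 1)).zero = ∅) :
    (step D (k + 2)).zero = ∅ :=
  Finset.eq_empty_of_forall_notMem fun i hi => by simpa [h] using (mem_zero_add_two.1 hi).1

theorem nextStep_of_stationary (hD : D.PosDef) {s : StepData n} (hs : s.IsPartition)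
    (h1 : s.star = ∅) (h2 : s.zero = ∅) :
    nextStep D s = ⟨0, s.plus, ∅, ∅, s.minus⟩ := by
  have hb : (nextStep D s).beta = 0 := by
    obtain ⟨hp, -, -, hm⟩ := (isMinimiser_nextStep hD hs).1
    refine eq_zero_of_complementary hD fun i => ?_
    have hi : i ∈ s.plus ∪ s.star ∪ s.zero ∪ s.minus := hs.1 ▸ Finset.mem_univ i
    simp only [h1, h2, Finset.union_empty, Finset.mem_union] at hi
    exact hi.imp (hp i) (hm i)
  have hb' : argmin (quad D) (nextSet D s) = 0 := hb
  simp [nextStep, hb', h1, h2]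

/-- Step k + 2 still moves F_*(k+1) into F₊ and may have a non-zero column; only from k + 3 on is
the state constant. -/
theorem step_after_zero_empty (hD : D.PosDef) {k : ℕ} (h : (step D (k + 1)).zero = ∅) (m : ℕ) :
    step D (k + m + 3) = ⟨0, (step D (k + 2)).plus, ∅, ∅, (step D (k + 2)).minus⟩ := by
  induction m with
  | zero =>
    exact nextStep_of_stationary hD (isPartition_step hD (k + 1)) (star_add_two_eq_empty h)
      (zero_add_two_eq_empty h)
  | succ m ih =>
    have h3 : step D (k + (m + 1) + 3) = nextStep D (step D (k + m + 3)) := rfl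
    rw [h3, nextStep_of_stationary hD (isPartition_step hD (k + m + 2)) (by rw [ih]) (by rw [ih]),
      ih]

theorem algorithmSound (hD : D.PosDef) : AlgorithmSound D := by
  refine ⟨isMinimiser_firstSet_iff hD, fun i _ => (rowBeta_one hD i).1,
    fun i => (rowBeta_one hD i).2, fun k hk => ?_, fun k hk => ?_, fun k hk h0 m hm => ?_⟩
  · obtain ⟨k, rfl⟩ := Nat.exists_eq_add_of_le' hk
    exact ⟨isMinimiser_nextSet_iff hD (isPartition_step hD k),
      fun i hi => (rowBeta_add_two hD hi).1, fun i hi => (rowBeta_add_two hD hi).2,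
      exists_rowBeta_neg hD⟩
  · obtain ⟨k, rfl⟩ := Nat.exists_eq_add_of_le' hk
    exact isPartition_step hD k
  · obtain ⟨k, rfl⟩ := Nat.exists_eq_add_of_le' hk
    obtain ⟨m, rfl⟩ := Nat.exists_eq_add_of_lt hm
    have := step_after_zero_empty hD (k := k) h0 m
    rwa [show k + 2 + m + 1 = k + m + 3 by omega]

/-! ### The final sets -/

theorem zero_final_eq_empty (hD : D.PosDef) : (step D (n + 1)).zero = ∅ := by
  by_contra h
  have := lt_of_zero_nonempty hD (Finset.nonempty_iff_ne_empty.2 h)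
  omega

theorem star_final_eq_empty (hD : D.PosDef) : (step D (n + 1)).star = ∅ := by
  -- For n = 0 the final step is the first one and has no predecessor; otherwise F₀(n) is already
  -- empty.
  cases n with
  | zero => exact Finset.eq_empty_of_isEmpty _
  | succ n =>
    refine star_add_two_eq_empty ?_
    by_contra h
    have := lt_of_zero_nonempty hD (Finset.nonempty_iff_ne_empty.2 h)
    omega

theorem isCompl_FPlus_FMinus (hD : D.PosDef) : IsCompl (FPlus D) (FMinus D) := by
  obtain ⟨hU, -, -, hpm, -⟩ := isPartition_step hD n
  refine ⟨hpm, codisjoint_iff.2 ?_⟩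
  rw [star_final_eq_empty hD, zero_final_eq_empty hD, Finset.union_empty, Finset.union_empty] at hU
  exact hU

theorem minus_one_subset (k : ℕ) : (step D 1).minus ⊆ (step D (k + 1)).minus := by
  induction k with
  | zero => exact subset_rfl
  | succ k ih => exact fun i hi => mem_minus_add_two.2 (Or.inl (ih hi))

/-- On `F₊` the number `ℓᵢ` is the step at which `i` was in `F_*`. -/
theorem FPlus_spec (hD : D.PosDef) {i : Fin n} (hi : i ∈ FPlus D) :
    IsLeast {j : ℕ | 1 ≤ j ∧ rowBeta D i j < 0} (ell D i) ∧ ell D i ≤ n ∧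
      i ∈ (step D (ell D i)).star ∧ ∀ j, 1 ≤ j → j ≤ n + 1 →
      beta D i j = (if j = 1 then -1 else 0) + (if j = ell D i + 1 then 1 else 0) := by
  obtain ⟨l, hl1, hl2, hl3, hl4⟩ := plus_history hD hi
  have hleast : IsLeast {j : ℕ | 1 ≤ j ∧ rowBeta D i j < 0} l := by
    obtain ⟨l, rfl⟩ := Nat.exists_eq_add_of_le' hl1
    obtain ⟨-, -, h1, h2⟩ := star_history hD hl3
    refine ⟨⟨hl1, h2⟩, fun j ⟨hj1, hj2⟩ => ?_⟩
    by_contra! h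
    exact hj2.ne (h1 j hj1 (by omega))
  have hell : ell D i = l := hleast.csInf_eq
  rw [hell]
  exact ⟨hleast, hl2, hl3, hl4⟩

theorem FMinus_spec (hD : D.PosDef) {i : Fin n} (hi : i ∈ FMinus D \ (step D 1).minus) :
    ∃ k : ℕ, 1 < k ∧ k ≤ n ∧ beta D i 1 = -1 ∧ (∀ j, 2 ≤ j → j < k → beta D i j = 0) ∧
      beta D i k < 0 := by
  rw [Finset.mem_sdiff] at hi
  obtain ⟨h1, m, -, h3, h4⟩ := (minus_history hD hi.1).2.resolve_left hi.2
  exact ⟨m + 2, by omega, lt_of_zero_nonempty hD ⟨i, h3⟩, h1, h4⟩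

theorem ell_lt_of_zero_eq_empty (hD : D.PosDef) {i : Fin n} (hi : i ∈ FPlus D) (hn : 2 ≤ n)
    (h0 : (step D (n - 1)).zero = ∅) : ell D i + 1 ≤ n := by
  obtain ⟨-, h1, h2, -⟩ := FPlus_spec hD hi
  by_contra! h
  obtain ⟨m, rfl⟩ := Nat.exists_eq_add_of_le' hn
  have h3 : ell D i = m + 2 := by omega
  rw [h3, star_add_two_eq_empty h0] at h2
  simp at h2

theorem isUnit_block (hD : D.PosDef) (A : Finset (Fin n)) : IsUnit (block D A A) :=
  (hD.submatrix Subtype.val_injective).isUnit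

/-! ### Stationary points of `h_θ` -/

/-- The gradient of `h_θ`. -/
noncomputable def gradTheta (μ : Fin n → ℝ) (D : Matrix (Fin n) (Fin n) ℝ) (θ : ℝ)
    (x : Fin n → ℝ) : Fin n → ℝ :=
  fun i => θ * (Real.exp (μ i) * Real.exp (x i)) + (D *ᵥ x) i

theorem continuous_hTheta (μ : Fin n → ℝ) (D : Matrix (Fin n) (Fin n) ℝ) (θ : ℝ) :
    Continuous (hTheta μ D θ) := by
  unfold hTheta
  fun_prop

theorem exists_minimiser_hTheta (hD : D.PosDef) (μ : Fin n → ℝ) {θ : ℝ} (hθ : 0 < θ) :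
    ∃ x, IsMinimiser (hTheta μ D θ) Set.univ x := by
  have hle : ∀ x, 1 / 2 * quad D x ≤ hTheta μ D θ x := fun x => by
    have : 0 ≤ θ * ∑ i, Real.exp (μ i) * Real.exp (x i) := by positivity
    simp only [hTheta, quad]
    linarith
  obtain ⟨x, hx⟩ := (continuous_hTheta μ D θ).exists_forall_le
    (tendsto_atTop_mono hle ((tendsto_quad_cocompact hD).const_mul_atTop one_half_pos))
  exact ⟨x, Set.mem_univ x, fun y _ => hx y⟩

theorem hasDerivAt_hTheta_line (hD : D.PosDef) (μ : Fin n → ℝ) (θ : ℝ) (x v : Fin n → ℝ) :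
    HasDerivAt (fun t : ℝ => hTheta μ D θ (x + t • v)) (v ⬝ᵥ gradTheta μ D θ x) 0 := by
  have h1 : HasDerivAt (fun t : ℝ => ∑ i, Real.exp (μ i) * Real.exp (x i + t * v i))
      (∑ i, Real.exp (μ i) * (Real.exp (x i + 0 * v i) * (1 * v i))) 0 :=
    HasDerivAt.fun_sum fun i _ =>
      ((((hasDerivAt_id (0 : ℝ)).mul_const (v i)).const_add (x i)).exp).const_mul _
  have h2 : HasDerivAt (fun t : ℝ => quad D x + 2 * t * (v ⬝ᵥ (D *ᵥ x)) + t ^ 2 * quad D v)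
      (2 * 1 * (v ⬝ᵥ (D *ᵥ x)) + (2 : ℕ) * (0 : ℝ) ^ (2 - 1) * quad D v) 0 :=
    ((((hasDerivAt_id (0 : ℝ)).const_mul 2).mul_const _).const_add _).add
      ((hasDerivAt_pow 2 (0 : ℝ)).mul_const _)
  have h3 := (h1.const_mul θ).add (h2.const_mul (1 / 2))
  refine (h3.congr_deriv ?_).congr_of_eventuallyEq (Eventually.of_forall fun t => ?_)
  · simp only [gradTheta, dotProduct, Finset.mul_sum, zero_mul, add_zero, one_mul]
    norm_num [Finset.mul_sum]
    rw [← Finset.sum_add_distrib]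
    exact Finset.sum_congr rfl fun i _ => by ring
  · have := quad_add_smul hD x v t
    simp only [quad] at this
    simp [hTheta, quad, this]

theorem gradTheta_eq_zero (hD : D.PosDef) {μ : Fin n → ℝ} {θ : ℝ} {x : Fin n → ℝ}
    (hx : IsMinimiser (hTheta μ D θ) Set.univ x) : gradTheta μ D θ x = 0 := by
  ext i
  have hmin : IsLocalMin (fun t : ℝ => hTheta μ D θ (x + t • Pi.single i (1 : ℝ))) 0 :=
    Eventually.of_forall fun t => by
      have := hx.2 (Set.mem_univ (x + t • Pi.single i (1 : ℝ)))
      simpa using this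
  have h := hmin.hasDerivAt_eq_zero (hasDerivAt_hTheta_line hD μ θ x (Pi.single i 1))
  simpa using h

/-- Monotonicity of the gradient, in the form of an identity. -/
theorem quad_sub_eq (μ : Fin n → ℝ) (D : Matrix (Fin n) (Fin n) ℝ) (θ : ℝ) (x y : Fin n → ℝ)
    (hx : gradTheta μ D θ x = 0) :
    quad D (y - x) = ∑ i, (gradTheta μ D θ y i * (y i - x i) -
      θ * (Real.exp (μ i) * Real.exp (y i)) * (1 - Real.exp (-(y i - x i))) * (y i - x i)) := by
  unfold quad dotProduct
  refine Finset.sum_congr rfl fun i _ => ?_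
  have h1 := congrFun hx i
  -- Everything is expressed through e^{yᵢ}, whose size is known at the approximate minimiser.
  have h2 : Real.exp (x i) = Real.exp (y i) * Real.exp (-(y i - x i)) := by
    rw [← Real.exp_add]
    ring_nf
  simp only [gradTheta, Pi.zero_apply, h2] at h1
  simp only [gradTheta, mulVec_sub, Pi.sub_apply]
  linear_combination (x i - y i) * h1

/-- The right side grows only linearly as d → +∞, so no multiple of d² can serve as a lower bound.
For d ≥ 0 use e^{−d} (1 + d) ≤ 1; for d ≤ 0 the right side even dominates d². -/
theorem sq_div_le_one_sub_exp_neg_mul (d : ℝ) :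
    d ^ 2 / (1 + |d|) ≤ (1 - Real.exp (-d)) * d := by
  have hpos : 0 < 1 + |d| := by positivity
  rw [div_le_iff₀ hpos]
  rcases le_total 0 d with h | h
  · rw [abs_of_nonneg h]
    have h1 := Real.add_one_le_exp d
    have h2 : Real.exp (-d) * (1 + d) ≤ 1 := by
      calc Real.exp (-d) * (1 + d) ≤ Real.exp (-d) * Real.exp d := by gcongr; linarith
        _ = 1 := by rw [← Real.exp_add]; simp
    nlinarith
  · rw [abs_of_nonpos h]
    have h1 := Real.add_one_le_exp (-d)
    have h2 : d ^ 2 ≤ (1 - Real.exp (-d)) * d := by nlinarith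
    have h3 : 0 ≤ (1 - Real.exp (-d)) * d := (sq_nonneg d).trans h2
    nlinarith

/-- For |d| ≤ 1 the subtracted term is at least A d²/2, and completing the square gives the bound.
For |d| ≥ 1 it is at least A |d|/2, which absorbs r d by the hypothesis on r. -/
theorem mul_sub_one_sub_exp_neg_mul_le {A r d : ℝ} (hA : 0 < A) (hr : |r| ≤ A / 2) :
    r * d - A * (1 - Real.exp (-d)) * d ≤ r ^ 2 / A := by
  have h1 := mul_le_mul_of_nonneg_left (sq_div_le_one_sub_exp_neg_mul d) hA.le
  have hpos : 0 < 1 + |d| := by positivity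
  have hrd : r * d ≤ |r| * |d| := by
    rw [← abs_mul]
    exact le_abs_self _
  have h0 : 0 ≤ r ^ 2 / A := by positivity
  rcases le_total |d| 1 with h | h
  · have h2 : d ^ 2 / 2 ≤ d ^ 2 / (1 + |d|) := by gcongr; linarith
    have h3 : r * d ≤ r ^ 2 / A + A * (d ^ 2 / 2) := by
      have h4 : r ^ 2 / A + A * (d ^ 2 / 2) - r * d
          = ((r - A * d / 2) ^ 2 + (A * d) ^ 2 / 4) / A := by
        field_simp
        ring
      have : 0 ≤ ((r - A * d / 2) ^ 2 + (A * d) ^ 2 / 4) / A := by positivity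
      linarith
    nlinarith
  · have h2 : |d| / 2 ≤ d ^ 2 / (1 + |d|) := by
      rw [div_le_div_iff₀ two_pos hpos, ← sq_abs]
      nlinarith
    have h3 : |r| * |d| ≤ A / 2 * |d| := by gcongr
    nlinarith

theorem existsUnique_minimiser_hTheta (hD : D.PosDef) (μ : Fin n → ℝ) {θ : ℝ} (hθ : 0 < θ) :
    ∃! x, IsMinimiser (hTheta μ D θ) Set.univ x := by
  obtain ⟨x, hx⟩ := exists_minimiser_hTheta hD μ hθ
  refine ⟨x, hx, fun y hy => sub_eq_zero.1 (eq_zero_of_quad_nonpos hD ?_)⟩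
  rw [quad_sub_eq μ D θ x y (gradTheta_eq_zero hD hx), gradTheta_eq_zero hD hy]
  refine Finset.sum_nonpos fun i _ => ?_
  -- Both points are stationary, so the scalar inequality applies with r = 0.
  have h := mul_sub_one_sub_exp_neg_mul_le (A := θ * (Real.exp (μ i) * Real.exp (y i))) (r := 0)
    (d := y i - x i) (by positivity) (by rw [abs_zero]; positivity)
  simpa using h

/-- A point with a small gradient is close to the minimiser. In the coordinates of `P` the gradient
need only be small relative to the square root of the exponential term. -/
theorem sq_norm_sub_le {l : ℝ} (hl : 0 < l) (hq : ∀ w : Fin n → ℝ, l * ‖w‖ ^ 2 ≤ quad D w)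
    {μ : Fin n → ℝ} {θ : ℝ} (hθ : 0 < θ) {x y : Fin n → ℝ} (hx : gradTheta μ D θ x = 0)
    {P M : Finset (Fin n)} (hPM : IsCompl P M)
    (hP : ∀ i ∈ P, |gradTheta μ D θ y i| ≤ θ * (Real.exp (μ i) * Real.exp (y i)) / 2) :
    ‖y - x‖ ^ 2 ≤ 2 / l * (∑ i ∈ P, gradTheta μ D θ y i ^ 2 /
      (θ * (Real.exp (μ i) * Real.exp (y i)))) + (∑ i ∈ M, |gradTheta μ D θ y i|) ^ 2 / l ^ 2 := by
  set p := ∑ i ∈ P, gradTheta μ D θ y i ^ 2 / (θ * (Real.exp (μ i) * Real.exp (y i)))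
  set s := ∑ i ∈ M, |gradTheta μ D θ y i| with hs
  have h1 : l * ‖y - x‖ ^ 2 ≤ p + s * ‖y - x‖ := by
    refine (hq (y - x)).trans ?_
    rw [quad_sub_eq μ D θ x y hx, ← Finset.sum_add_sum_compl P, hPM.compl_eq, hs, Finset.sum_mul]
    refine add_le_add (Finset.sum_le_sum fun i hi => ?_) (Finset.sum_le_sum fun i _ => ?_)
    · exact mul_sub_one_sub_exp_neg_mul_le (by positivity) (hP i hi)
    -- On M the exponential term has a favourable sign and is dropped.
    · have h2 : 0 ≤ θ * (Real.exp (μ i) * Real.exp (y i)) *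
          ((1 - Real.exp (-(y i - x i))) * (y i - x i)) :=
        mul_nonneg (by positivity)
          (le_trans (by positivity) (sq_div_le_one_sub_exp_neg_mul (y i - x i)))
      have h3 : gradTheta μ D θ y i * (y i - x i) ≤ |gradTheta μ D θ y i| * ‖y - x‖ := by
        refine (le_abs_self _).trans ?_
        rw [abs_mul]
        gcongr
        exact norm_le_pi_norm (y - x) i
      linarith
  -- Completing the square solves the quadratic inequality `h1` for the norm without taking roots.
  have h2 : 2 / l * p + s ^ 2 / l ^ 2 - ‖y - x‖ ^ 2 =
      (2 * l * (p + s * ‖y - x‖ - l * ‖y - x‖ ^ 2) + (l * ‖y - x‖ - s) ^ 2) / l ^ 2 := by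
    field_simp
    ring
  have h3 : 0 ≤ (2 * l * (p + s * ‖y - x‖ - l * ‖y - x‖ ^ 2) + (l * ‖y - x‖ - s) ^ 2) / l ^ 2 := by
    have := sub_nonneg.2 h1
    positivity
  linarith

/-! ### Iterated logarithms -/

theorem iterLog_succ (k : ℕ) (θ : ℝ) : iterLog (k + 1) θ = Real.log (iterLog k θ) :=
  Function.iterate_succ_apply' _ _ _

theorem tendsto_iterLog (k : ℕ) : Tendsto (iterLog k) atTop atTop := by
  induction k with
  | zero => exact tendsto_id
  | succ k ih => exact (Real.tendsto_log_atTop.comp ih).congr fun θ => (iterLog_succ k θ).symm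

/-- The case m = 2 is what makes the squared gradient on F₊ negligible; m = 1 orders the scales. -/
theorem isLittleO_iterLog_succ_pow (k m : ℕ) :
    (fun θ => iterLog (k + 1) θ ^ m) =o[atTop] iterLog k := by
  simp only [iterLog_succ]
  exact (Real.isLittleO_pow_log_id_atTop (n := m)).comp_tendsto (tendsto_iterLog k)

theorem isLittleO_iterLog {k j : ℕ} (h : k < j) : iterLog j =o[atTop] iterLog k := by
  induction j, h using Nat.le_induction with
  | base => simpa using isLittleO_iterLog_succ_pow k 1
  | succ j _ ih => exact (by simpa using isLittleO_iterLog_succ_pow j 1 :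
      iterLog (j + 1) =o[atTop] iterLog j).trans ih

theorem tendsto_iterLog_div_iterLog {k j : ℕ} (h : k ≤ j) :
    Tendsto (fun θ => iterLog j θ / iterLog k θ) atTop (𝓝 (if j = k then 1 else 0)) := by
  rcases h.eq_or_lt with rfl | h
  · rw [if_pos rfl]
    refine tendsto_const_nhds.congr' ?_
    filter_upwards [(tendsto_iterLog k).eventually_ne_atTop 0] with θ hθ
    rw [div_self hθ]
  · rw [if_neg h.ne']
    exact (isLittleO_iterLog h).tendsto_div_nhds_zero

/-- The leading term of a combination of iterated logarithms. -/
theorem tendsto_sum_iterLog_div {a : ℕ → ℝ} {s : Finset ℕ} {k : ℕ}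
    (ha : ∀ j ∈ s, j < k → a j = 0) :
    Tendsto (fun θ => (∑ j ∈ s, a j * iterLog j θ) / iterLog k θ) atTop
      (𝓝 (∑ j ∈ s, a j * if j = k then 1 else 0)) := by
  simp only [Finset.sum_div, mul_div_assoc]
  refine tendsto_finsetSum _ fun j hj => ?_
  rcases lt_or_ge j k with h | h
  · simp [ha j hj h]
  · exact (tendsto_iterLog_div_iterLog h).const_mul _

theorem tendsto_sum_iterLog_atBot {a : ℕ → ℝ} {s : Finset ℕ} {k : ℕ} (hk : k ∈ s)
    (ha : ∀ j ∈ s, j < k → a j = 0) (hneg : a k < 0) :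
    Tendsto (fun θ => ∑ j ∈ s, a j * iterLog j θ) atTop atBot := by
  have h := tendsto_sum_iterLog_div ha
  have h0 : ∑ j ∈ s, (a j * if j = k then 1 else 0) = a k := by
    simp [hk]
  rw [h0] at h
  refine ((tendsto_iterLog k).atTop_mul_neg hneg h).congr' ?_
  filter_upwards [(tendsto_iterLog k).eventually_ne_atTop 0] with θ hθ
  rw [mul_div_cancel₀ _ hθ]

/-! ### The blocks of `D` -/

/-- Factoring D₋₋ out of D₋₋ v₋ + D₋₊ v₊ leaves v₋ − C v₊. Hence D v vanishes on F₋ exactly when v₋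
= C v₊, which explains both the choice of c₋ and the last claim of the theorem. -/
theorem mulVec_FMinus (hD : D.PosDef) (v : Fin n → ℝ) (i : FMinus D) :
    (D *ᵥ v) i = (block D (FMinus D) (FMinus D) *ᵥ
      fun m => v m - (CMat D *ᵥ fun p : FPlus D => v p) m) i := by
  have hu := (Matrix.isUnit_iff_isUnit_det _).1 (isUnit_block hD (FMinus D))
  have h1 : (fun m : FMinus D => v m - (CMat D *ᵥ fun p : FPlus D => v p) m) =
      (fun m : FMinus D => v m) - CMat D *ᵥ fun p : FPlus D => v p := rfl
  rw [h1, mulVec_sub, mulVec_mulVec, CMat, Matrix.mul_neg, Matrix.mul_nonsing_inv_cancel_left _ _ hu,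
    neg_mulVec, sub_neg_eq_add, Pi.add_apply]
  simp only [mulVec, dotProduct, block, submatrix_apply]
  have h2 := Finset.sum_add_sum_compl (FPlus D) fun j => D i j * v j
  rw [(isCompl_FPlus_FMinus hD).compl_eq, ← Finset.sum_coe_sort (FMinus D),
    ← Finset.sum_coe_sort (FPlus D)] at h2
  rw [← h2, add_comm]

theorem mulVec_FMinus_eq_zero_iff (hD : D.PosDef) (v : Fin n → ℝ) :
    (∀ i ∈ FMinus D, (D *ᵥ v) i = 0) ↔
      ∀ i : FMinus D, v i = (CMat D *ᵥ fun p : FPlus D => v p) i := by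
  have hinj := Matrix.mulVec_injective_of_isUnit (isUnit_block hD (FMinus D))
  constructor
  · intro h i
    have h0 : (fun m : FMinus D => v m - (CMat D *ᵥ fun p : FPlus D => v p) m) = 0 := by
      refine hinj (funext fun m => ?_)
      rw [← mulVec_FMinus hD v m, h m m.2, mulVec_zero, Pi.zero_apply]
    exact sub_eq_zero.1 (congrFun h0 i)
  · intro h i hi
    have h0 : (fun m : FMinus D => v m - (CMat D *ᵥ fun p : FPlus D => v p) m) = 0 :=
      funext fun m => sub_eq_zero.2 (h m)
    rw [mulVec_FMinus hD v ⟨i, hi⟩, h0, mulVec_zero, Pi.zero_apply]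

theorem cVec_of_mem_FPlus (hD : D.PosDef) (μ : Fin n → ℝ) {i : Fin n} (hi : i ∈ FPlus D) :
    cVec μ D i = cPlus D i :=
  dif_neg (Finset.disjoint_left.1 (isCompl_FPlus_FMinus hD).disjoint hi)

theorem mulVec_cVec_sub (hD : D.PosDef) (μ : Fin n → ℝ) :
    ∀ i ∈ FMinus D, (D *ᵥ (cVec μ D - μ)) i = 0 := by
  rw [mulVec_FMinus_eq_zero_iff hD]
  intro i
  have h : (fun p : FPlus D => (cVec μ D - μ) p) = fun p : FPlus D => cPlus D p.1 - μ p.1 :=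
    funext fun p => by rw [Pi.sub_apply, cVec_of_mem_FPlus hD μ p.2]
  rw [h, Pi.sub_apply, cVec, dif_pos i.2, add_sub_cancel_right]

/-! ### The approximate minimiser -/

/-- The approximation of the minimiser of `h_θ`. -/
noncomputable def approxMin (μ : Fin n → ℝ) (D : Matrix (Fin n) (Fin n) ℝ) (θ : ℝ) : Fin n → ℝ :=
  fun i => (∑ j ∈ Finset.Icc 1 (n + 1), beta D i j * iterLog j θ) - μ i + cVec μ D i

theorem mulVec_approxMin (μ : Fin n → ℝ) (D : Matrix (Fin n) (Fin n) ℝ) (θ : ℝ) (i : Fin n) :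
    (D *ᵥ approxMin μ D θ) i = (∑ j ∈ Finset.Icc 1 (n + 1), rowBeta D i j * iterLog j θ) +
      (D *ᵥ (cVec μ D - μ)) i := by
  have h : approxMin μ D θ =
      (∑ j ∈ Finset.Icc 1 (n + 1), iterLog j θ • (step D j).beta) + (cVec μ D - μ) := by
    ext i
    simp only [approxMin, beta, Pi.add_apply, Finset.sum_apply, Pi.smul_apply, smul_eq_mul,
      Pi.sub_apply, mul_comm (iterLog _ θ)]
    ring
  rw [h, mulVec_add, Pi.add_apply, mulVec_sum, Finset.sum_apply]
  simp [rowBeta, mulVec_smul, mul_comm]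

theorem rowBeta_FMinus (hD : D.PosDef) {i : Fin n} (hi : i ∈ FMinus D) {j : ℕ}
    (hj : j ∈ Finset.Icc 1 (n + 1)) : rowBeta D i j = 0 :=
  (minus_history hD hi).1 j (Finset.mem_Icc.1 hj).1 (Finset.mem_Icc.1 hj).2

theorem mulVec_approxMin_FMinus (hD : D.PosDef) (μ : Fin n → ℝ) (θ : ℝ) :
    ∀ i ∈ FMinus D, (D *ᵥ approxMin μ D θ) i = 0 := by
  intro i hi
  rw [mulVec_approxMin, mulVec_cVec_sub hD μ i hi, add_zero]
  exact Finset.sum_eq_zero fun j hj => by rw [rowBeta_FMinus hD hi hj, zero_mul]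

theorem approxMin_FPlus (hD : D.PosDef) (μ : Fin n → ℝ) {i : Fin n} (hi : i ∈ FPlus D) (θ : ℝ) :
    approxMin μ D θ i =
      -Real.log θ + iterLog (ell D i + 1) θ - μ i + cVec μ D i := by
  obtain ⟨hl, hln, -, hb⟩ := FPlus_spec hD hi
  have h : ∑ j ∈ Finset.Icc 1 (n + 1), beta D i j * iterLog j θ =
      -iterLog 1 θ + iterLog (ell D i + 1) θ := by
    rw [Finset.sum_congr rfl fun j hj => by
      rw [hb j (Finset.mem_Icc.1 hj).1 (Finset.mem_Icc.1 hj).2, add_mul, ite_mul, ite_mul]]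
    simp only [zero_mul]
    rw [Finset.sum_add_distrib, Finset.sum_ite_eq', Finset.sum_ite_eq',
      if_pos (by simp), if_pos (Finset.mem_Icc.2 (by omega))]
    ring
  rw [approxMin, h]
  rfl

/-- This is where cᵢ is determined: the exponential term must balance the leading term of (D y)ᵢ.
Large θ is needed for log_{ℓᵢ} θ to be positive. -/
theorem exp_approxMin_FPlus (hD : D.PosDef) (μ : Fin n → ℝ) {i : Fin n} (hi : i ∈ FPlus D) :
    ∀ᶠ θ in atTop, θ * (Real.exp (μ i) * Real.exp (approxMin μ D θ i)) =
      -rowBeta D i (ell D i) * iterLog (ell D i) θ := by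
  obtain ⟨hl, -⟩ := FPlus_spec hD hi
  filter_upwards [eventually_gt_atTop 0, (tendsto_iterLog (ell D i)).eventually_gt_atTop 0]
    with θ hθ hlog
  have hc : Real.exp (cVec μ D i) = -rowBeta D i (ell D i) := by
    rw [cVec_of_mem_FPlus hD μ hi, cPlus, Real.exp_log (neg_pos.2 hl.1.2)]
  rw [approxMin_FPlus hD μ hi, iterLog_succ, Real.exp_add, Real.exp_sub, Real.exp_add,
    Real.exp_neg, Real.exp_log hθ, Real.exp_log hlog, hc]
  field_simp

theorem tendsto_exp_approxMin_FMinus (hD : D.PosDef) (μ : Fin n → ℝ) {i : Fin n}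
    (hi : i ∈ FMinus D) :
    Tendsto (fun θ => θ * (Real.exp (μ i) * Real.exp (approxMin μ D θ i))) atTop (𝓝 0) := by
  -- The factor θ adds 1 to the coefficient of log₁ θ. The first non-zero coefficient is then
  -- negative: it sits at k = 1 on F₋(1), and at the step of entry for the rest of F₋.
  obtain ⟨k, hk, hk', hneg⟩ : ∃ k ∈ Finset.Icc 1 (n + 1),
      (∀ j ∈ Finset.Icc 1 (n + 1), j < k → (beta D i j + if j = 1 then 1 else 0) = 0) ∧
      beta D i k + (if k = 1 then 1 else 0) < 0 := by
    by_cases h1 : i ∈ (step D 1).minus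
    · refine ⟨1, by simp, fun j hj hj' => ?_, ?_⟩
      · exact absurd (Finset.mem_Icc.1 hj).1 (by omega)
      · have := mem_minus_one.1 h1
        simp only [if_true]
        linarith
    · obtain ⟨k, h2, h3, h4, h5, h6⟩ := FMinus_spec hD (Finset.mem_sdiff.2 ⟨hi, h1⟩)
      refine ⟨k, Finset.mem_Icc.2 ⟨by omega, by omega⟩, fun j hj hj' => ?_, ?_⟩
      · by_cases h : j = 1
        · subst h
          simp [h4]
        · rw [if_neg h, add_zero]
          exact h5 j (by have := (Finset.mem_Icc.1 hj).1; omega) hj'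
      · rwa [if_neg (by omega), add_zero]
  have h := tendsto_sum_iterLog_atBot hk hk' hneg
  have h2 := (Real.tendsto_exp_atBot.comp (tendsto_atBot_add_const_right _ (cVec μ D i) h))
  refine h2.congr' ?_
  filter_upwards [eventually_gt_atTop 0] with θ hθ
  have h3 : ∑ j ∈ Finset.Icc 1 (n + 1), (beta D i j + if j = 1 then 1 else 0) * iterLog j θ =
      (∑ j ∈ Finset.Icc 1 (n + 1), beta D i j * iterLog j θ) + Real.log θ := by
    simp only [add_mul, Finset.sum_add_distrib, ite_mul, zero_mul, one_mul]
    rw [Finset.sum_ite_eq', if_pos (by simp)]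
    rfl
  rw [Function.comp_apply, h3, approxMin]
  conv_rhs => rw [← Real.exp_log hθ, ← Real.exp_add, ← Real.exp_add, Real.exp_log hθ]
  ring_nf

theorem tendsto_gradTheta_FMinus (hD : D.PosDef) (μ : Fin n → ℝ) {i : Fin n}
    (hi : i ∈ FMinus D) :
    Tendsto (fun θ => gradTheta μ D θ (approxMin μ D θ) i) atTop (𝓝 0) := by
  refine (tendsto_exp_approxMin_FMinus hD μ hi).congr fun θ => ?_
  rw [gradTheta, mulVec_approxMin_FMinus hD μ θ i hi, add_zero]

/-- On `F₊` the gradient at the approximate minimiser is of lower order. -/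
theorem tendsto_gradTheta_FPlus (hD : D.PosDef) (μ : Fin n → ℝ) {i : Fin n} (hi : i ∈ FPlus D) :
    ∃ L, Tendsto (fun θ => gradTheta μ D θ (approxMin μ D θ) i / iterLog (ell D i + 1) θ)
      atTop (𝓝 L) := by
  obtain ⟨hl, hln, -⟩ := FPlus_spec hD hi
  set l := ell D i
  -- The row coefficients without the term at l, which the exponential term cancels; those before l
  -- vanish by minimality of l.
  set a : ℕ → ℝ := fun j => rowBeta D i j - if j = l then rowBeta D i l else 0 with ha
  have ha0 : ∀ j ∈ Finset.Icc 1 (n + 1), j < l + 1 → a j = 0 := by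
    intro j hj hjl
    by_cases h : j = l
    · simp [ha, h]
    · have h1 := (Finset.mem_Icc.1 hj).1
      have hstar := (FPlus_spec hD hi).2.2.1
      obtain ⟨m, hm⟩ := Nat.exists_eq_add_of_le' hl.1.1
      have h2 := (star_history hD (k := m) (i := i) (hm ▸ hstar)).2.2.1 j h1 (by omega)
      simp [ha, h, h2]
  have h1 := tendsto_sum_iterLog_div ha0
  have h2 : Tendsto (fun θ => (D *ᵥ (cVec μ D - μ)) i / iterLog (l + 1) θ) atTop (𝓝 0) :=
    tendsto_const_nhds.div_atTop (tendsto_iterLog _)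
  refine ⟨_, (h1.add h2).congr' ?_⟩
  filter_upwards [exp_approxMin_FPlus hD μ hi] with θ hθ
  rw [gradTheta, hθ, mulVec_approxMin, ← add_div]
  have h3 : ∑ j ∈ Finset.Icc 1 (n + 1), a j * iterLog j θ =
      (∑ j ∈ Finset.Icc 1 (n + 1), rowBeta D i j * iterLog j θ) - rowBeta D i l * iterLog l θ := by
    simp only [ha, sub_mul, Finset.sum_sub_distrib, ite_mul, zero_mul]
    rw [Finset.sum_ite_eq', if_pos (Finset.mem_Icc.2 ⟨hl.1.1, by omega⟩)]
  rw [h3]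
  ring

/-- The numerator is O((log_{ℓᵢ+1} θ)²), while the denominator is a positive multiple of log_{ℓᵢ} θ.
-/
theorem tendsto_sq_gradTheta_div_FPlus (hD : D.PosDef) (μ : Fin n → ℝ) {i : Fin n}
    (hi : i ∈ FPlus D) :
    Tendsto (fun θ => gradTheta μ D θ (approxMin μ D θ) i ^ 2 /
      (θ * (Real.exp (μ i) * Real.exp (approxMin μ D θ i)))) atTop (𝓝 0) := by
  obtain ⟨L, hL⟩ := tendsto_gradTheta_FPlus hD μ hi
  obtain ⟨hl, -⟩ := FPlus_spec hD hi
  have h1 := (isLittleO_iterLog_succ_pow (ell D i) 2).tendsto_div_nhds_zero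
  have h2 := ((hL.pow 2).mul h1).div_const (-rowBeta D i (ell D i))
  rw [mul_zero, zero_div] at h2
  refine h2.congr' ?_
  filter_upwards [exp_approxMin_FPlus hD μ hi,
    (tendsto_iterLog (ell D i + 1)).eventually_ne_atTop 0,
    (tendsto_iterLog (ell D i)).eventually_ne_atTop 0] with θ hθ h3 h4
  rw [hθ]
  have h5 := hl.1.2.ne
  field_simp

theorem tendsto_exp_approxMin_FPlus (hD : D.PosDef) (μ : Fin n → ℝ) {i : Fin n}
    (hi : i ∈ FPlus D) :
    Tendsto (fun θ => θ * (Real.exp (μ i) * Real.exp (approxMin μ D θ i))) atTop atTop := by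
  obtain ⟨hl, -⟩ := FPlus_spec hD hi
  refine ((tendsto_iterLog (ell D i)).const_mul_atTop (neg_pos.2 hl.1.2)).congr' ?_
  filter_upwards [exp_approxMin_FPlus hD μ hi] with θ hθ
  exact hθ.symm

theorem eventually_gradTheta_le_FPlus (hD : D.PosDef) (μ : Fin n → ℝ) {i : Fin n}
    (hi : i ∈ FPlus D) :
    ∀ᶠ θ in atTop, |gradTheta μ D θ (approxMin μ D θ) i| ≤
      θ * (Real.exp (μ i) * Real.exp (approxMin μ D θ i)) / 2 := by
  -- With A the exponential term and g the gradient entry, g² ≤ A and A ≥ 4 give g² ≤ (A/2)².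
  filter_upwards [(tendsto_sq_gradTheta_div_FPlus hD μ hi).eventually (ge_mem_nhds one_pos),
    (tendsto_exp_approxMin_FPlus hD μ hi).eventually_ge_atTop 4] with θ h1 h2
  rw [div_le_one (by linarith)] at h1
  refine abs_le_of_sq_le_sq ?_ (by linarith)
  nlinarith

theorem tendsto_sub_approxMin (hD : D.PosDef) {μ : Fin n → ℝ} {x : ℝ → Fin n → ℝ}
    (hx : ∀ θ : ℝ, 0 < θ → IsMinimiser (hTheta μ D θ) Set.univ (x θ)) :
    Tendsto (fun θ => x θ - approxMin μ D θ) atTop (𝓝 0) := by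
  obtain ⟨l, hl, hq⟩ := exists_coercivity_constant hD
  have hlim : Tendsto (fun θ => 2 / l * (∑ i ∈ FPlus D,
      gradTheta μ D θ (approxMin μ D θ) i ^ 2 /
        (θ * (Real.exp (μ i) * Real.exp (approxMin μ D θ i)))) +
      (∑ i ∈ FMinus D, |gradTheta μ D θ (approxMin μ D θ) i|) ^ 2 / l ^ 2) atTop (𝓝 0) := by
    have h1 := tendsto_finsetSum (FPlus D) fun i hi => tendsto_sq_gradTheta_div_FPlus hD μ hi
    have h2 := tendsto_finsetSum (FMinus D) fun i hi => (tendsto_gradTheta_FMinus hD μ hi).abs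
    simpa using (h1.const_mul (2 / l)).add ((h2.pow 2).div_const (l ^ 2))
  have hsq : Tendsto (fun θ => ‖x θ - approxMin μ D θ‖ ^ 2) atTop (𝓝 0) := by
    refine tendsto_of_tendsto_of_tendsto_of_le_of_le' tendsto_const_nhds hlim
      (Eventually.of_forall fun θ => by positivity) ?_
    filter_upwards [eventually_gt_atTop 0, (Finset.eventually_all (FPlus D)).2 fun i hi =>
      eventually_gradTheta_le_FPlus hD μ hi] with θ hθ hP
    rw [norm_sub_rev]
    exact sq_norm_sub_le hl hq hθ (gradTheta_eq_zero hD (hx θ hθ)) (isCompl_FPlus_FMinus hD) hP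
  rw [tendsto_zero_iff_norm_tendsto_zero]
  simpa using hsq.sqrt

/-- The approximate minimiser satisfies y₋ = C y₊ exactly, so only the error x − y remains, under a
continuous linear map. -/
theorem tendsto_sub_CMat_mulVec (hD : D.PosDef) {μ : Fin n → ℝ} {x : ℝ → Fin n → ℝ}
    (hx : ∀ θ : ℝ, 0 < θ → IsMinimiser (hTheta μ D θ) Set.univ (x θ)) (i : FMinus D) :
    Tendsto (fun θ : ℝ => x θ i.1 - (CMat D *ᵥ fun p : FPlus D => x θ p.1) i) atTop (𝓝 0) := by
  have hcont : Continuous fun v : Fin n → ℝ =>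
      v i.1 - (CMat D *ᵥ fun p : FPlus D => v p.1) i := by
    unfold mulVec dotProduct
    fun_prop
  have h := (hcont.tendsto 0).comp (tendsto_sub_approxMin hD hx)
  have h0 : (0 : Fin n → ℝ) i.1 - (CMat D *ᵥ fun p : FPlus D => (0 : Fin n → ℝ) p.1) i = 0 := by
    simp [mulVec, dotProduct]
  rw [h0] at h
  refine h.congr fun θ => ?_
  have h1 := (mulVec_FMinus_eq_zero_iff hD _).1 (mulVec_approxMin_FMinus hD μ θ) i
  have h2 : (fun p : FPlus D => (x θ - approxMin μ D θ) p.1) =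
      (fun p : FPlus D => x θ p.1) - fun p : FPlus D => approxMin μ D θ p.1 := rfl
  rw [Function.comp_apply, h2, mulVec_sub, Pi.sub_apply, Pi.sub_apply, h1]
  ring

end LognormalSum

theorem mainTheorem1 {n : ℕ} (μ : Fin n → ℝ) (Sigma D : Matrix (Fin n) (Fin n) ℝ)
    (hSigma : Sigma.PosDef) (hD : D = Sigma⁻¹) :
    -- the minimiser of `h_θ` exists and is unique
    (∀ θ : ℝ, 0 < θ →
      ∃! x : Fin n → ℝ, LognormalSum.IsMinimiser (LognormalSum.hTheta μ D θ) Set.univ x) ∧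
    -- the algorithm is well defined, with the properties claimed in its description
    LognormalSum.AlgorithmSound D ∧
    -- `F₊`, `F₋` partition the indices, and `F₋(1) ⊆ F₋`
    IsCompl (LognormalSum.FPlus D) (LognormalSum.FMinus D) ∧
    (LognormalSum.step D 1).minus ⊆ LognormalSum.FMinus D ∧
    -- sign patterns on `F₋`
    (∀ i ∈ (LognormalSum.step D 1).minus, LognormalSum.beta D i 1 < -1) ∧
    (∀ i ∈ LognormalSum.FMinus D \ (LognormalSum.step D 1).minus,
      ∃ k : ℕ, 1 < k ∧ k ≤ n ∧ LognormalSum.beta D i 1 = -1 ∧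
        (∀ j, 2 ≤ j → j < k → LognormalSum.beta D i j = 0) ∧ LognormalSum.beta D i k < 0) ∧
    -- the constants on `F₊` are well defined, and `kᵢ = ℓᵢ + 1` is in the stated range
    (∀ i ∈ LognormalSum.FPlus D,
      IsLeast {j : ℕ | 1 ≤ j ∧ LognormalSum.rowBeta D i j < 0} (LognormalSum.ell D i) ∧
      1 < LognormalSum.ell D i + 1 ∧ LognormalSum.ell D i + 1 ≤ n + 1 ∧
      (2 ≤ n → (LognormalSum.step D (n - 1)).zero = ∅ → LognormalSum.ell D i + 1 ≤ n)) ∧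
    -- `D₋₋` is invertible
    IsUnit (LognormalSum.block D (LognormalSum.FMinus D) (LognormalSum.FMinus D)) ∧
    -- the asymptotic form of the minimiser
    ∀ x : ℝ → Fin n → ℝ,
      (∀ θ : ℝ, 0 < θ →
        LognormalSum.IsMinimiser (LognormalSum.hTheta μ D θ) Set.univ (x θ)) →
      (∀ i ∈ LognormalSum.FPlus D,
        Tendsto (fun θ : ℝ => x θ i - (-Real.log θ
          + LognormalSum.iterLog (LognormalSum.ell D i + 1) θ - μ i + LognormalSum.cVec μ D i))
          atTop (𝓝 0)) ∧
      (∀ i : Fin n,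
        Tendsto (fun θ : ℝ => x θ i - ((∑ j ∈ Finset.Icc 1 (n + 1),
          LognormalSum.beta D i j * LognormalSum.iterLog j θ) - μ i + LognormalSum.cVec μ D i))
          atTop (𝓝 0)) ∧
      (∀ i : LognormalSum.FMinus D,
        Tendsto (fun θ : ℝ => x θ i.1
          - (LognormalSum.CMat D *ᵥ fun p : LognormalSum.FPlus D => x θ p.1) i)
          atTop (𝓝 0)) := by

  have hD' : D.PosDef := hD ▸ hSigma.inv
  refine ⟨fun θ hθ => LognormalSum.existsUnique_minimiser_hTheta hD' μ hθ,
    LognormalSum.algorithmSound hD', LognormalSum.isCompl_FPlus_FMinus hD',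
    LognormalSum.minus_one_subset n, fun i hi => LognormalSum.mem_minus_one.1 hi,
    fun i hi => LognormalSum.FMinus_spec hD' hi, fun i hi => ?_,
    LognormalSum.isUnit_block hD' _, fun x hx => ?_⟩
  · obtain ⟨h1, h2, -⟩ := LognormalSum.FPlus_spec hD' hi
    exact ⟨h1, Nat.lt_succ_of_le h1.1.1, Nat.succ_le_succ h2,
      LognormalSum.ell_lt_of_zero_eq_empty hD' hi⟩
  · have hlim := fun i => tendsto_pi_nhds.1 (LognormalSum.tendsto_sub_approxMin hD' hx) i
    exact ⟨fun i hi => (hlim i).congr fun θ => by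
        rw [Pi.sub_apply, LognormalSum.approxMin_FPlus hD' μ hi],
      hlim, LognormalSum.tendsto_sub_CMat_mulVec hD' hx⟩
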